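/- Let $(W,S)$ be a Coxeter system with $S$ finite, $|S|=n$, and orders $m_{st}$, and let $B$ be a real symmetric matrix with $B_{st}=-\cos(\pi/m_{st})$ if $m_{st}<\infty$ and $B_{st}=-c_{st}$ if $m_{st}=\infty$, where the $c_{st}=c_{ts}\ge 1$ are arbitrary. Let $V$ be the real vector space with basis $\Delta=\{\alpha_s\}_{s\in S}$ (the simple roots) and bilinear form $\mathcal B$ with $\mathcal B(\alpha_s,\alpha_t)=B_{st}$, and let $W$ act linearly on $V$ by letting $s\in S$ act as the reflection $\mathbf x\mapsto \mathbf x-2\frac{\mathcal B(\mathbf x,\alpha_s)}{\mathcal B(\alpha_s,\alpha_s)}\alpha_s$. Let $\Phi=W(\Delta)$ be the set of roots. For $0\ne\mathbf x\in V$ write $\widehat{\mathbf x}\in\mathbb PV$ for its direction; $W$ acts on $\mathbb PV$ by $w\cdot\widehat{\mathbf x}=\widehat{w(\mathbf x)}$. A limit root is a point of $\mathbb PV$ that is the limit of $(\widehat{\gamma_i})_{i\in\mathbb N}$ for some injective sequence $(\gamma_i)_{i\in\mathbb N}$ in $\Phi$. Assume that $\mathcal B$ has signature $(n-1,1)$.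 Let $w\in W$ be parabolic, that is, all eigenvalues of $w$ on $V_{\mathbb C}=\mathbb C\otimes V$ have modulus $1$, but $w$ is not diagonalizable on $V_{\mathbb C}$. Let $U_w\subset V$ be the real subspace spanned by the unimodular eigenvectors of $w$, that is, the set of vectors of $V$ lying in the complex span of the eigenvectors of $w$ in $V_{\mathbb C}$ with eigenvalue of modulus $1$. Then $w$ has exactly one light-like eigendirection, that is, exactly one $\widehat{\mathbf x}\in\mathbb PV$ such that $\mathbf x\in V\setminus\{0\}$ is an eigenvector of $w$ with $\mathcal B(\mathbf x,\mathbf x)=0$. This $\widehat{\mathbf x}$ is a limit root. Moreover, for every $\mathbf y\in V\setminus U_w$, the points $w^k\cdot\widehat{\mathbf y}$, $k\in\mathbb N$, are pairwise distinct and converge to $\widehat{\mathbf x}$ as $k\to\infty$. -/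

import Mathlib

open scoped LinearAlgebra.Projectivization TensorProduct Topology

noncomputable section

/-- The projective space of a real topological vector space carries the quotient topology of
`V ∖ {0}`. -/
instance projectivizationTopology (V : Type*) [AddCommGroup V] [Module ℝ V]
    [TopologicalSpace V] : TopologicalSpace (ℙ ℝ V) :=
  TopologicalSpace.coinduced (Projectivization.mk' ℝ : {v : V // v ≠ 0} → ℙ ℝ V) inferInstance

namespace LinearMap.BilinForm

variable {V : Type*} [AddCommGroup V] [Module ℝ V]

/-- The reflection `σ_α(x) = x - 2 B(x, α) / B(α, α) • α` in a non-isotropic vector `α`. -/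
def vectorReflection (B : LinearMap.BilinForm ℝ V) (α : V) (h : B α α ≠ 0) : V ≃ₗ[ℝ] V :=
  Module.reflection (x := α) (f := (2 / B α α) • B.flip α) (by simp [h])

theorem vectorReflection_apply (B : LinearMap.BilinForm ℝ V) (α : V) (h : B α α ≠ 0) (x : V) :
    B.vectorReflection α h x = x - (2 * (B x α / B α α)) • α := by
  simp only [vectorReflection, Module.reflection_apply, LinearMap.smul_apply,
    LinearMap.BilinForm.flip_apply, smul_eq_mul]
  congr 2
  ring

/-- `B` is Lorentzian: it has signature `(n - 1, 1)`, where `n = dim V`. -/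
def IsLorentzian (B : LinearMap.BilinForm ℝ V) : Prop :=
  sigPos B.toQuadraticMap + 1 = Module.finrank ℝ V ∧ sigNeg B.toQuadraticMap = 1

end LinearMap.BilinForm

namespace Module.End

variable {V : Type*} [AddCommGroup V] [Module ℝ V]

/-- The complexification of a real endomorphism, acting on `ℂ ⊗ V`. -/
abbrev complexify (φ : Module.End ℝ V) : Module.End ℂ (ℂ ⊗[ℝ] V) := LinearMap.baseChange ℂ φ

/-- Diagonalizability over `ℂ`: the complexification is spanned by its eigenvectors. -/
def IsComplexDiagonalizable (φ : Module.End ℝ V) : Prop :=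
  Submodule.span ℂ {z : ℂ ⊗[ℝ] V | ∃ μ : ℂ, φ.complexify.HasEigenvector μ z} = ⊤

/-- Parabolic transformations: all complex eigenvalues are unimodular, but the transformation is
not diagonalizable. -/
def IsParabolic (φ : Module.End ℝ V) : Prop :=
  (∀ μ : ℂ, φ.complexify.HasEigenvalue μ → ‖μ‖ = 1) ∧ ¬ φ.IsComplexDiagonalizable

/-- The unimodular subspace: the real vectors in the span of the complex unimodular
eigenvectors. -/
def unimodularSubspace (φ : Module.End ℝ V) : Submodule ℝ V :=
  ((Submodule.span ℂ {z : ℂ ⊗[ℝ] V | ∃ μ : ℂ, ‖μ‖ = 1 ∧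
    φ.complexify.HasEigenvector μ z}).restrictScalars ℝ).comap (TensorProduct.mk ℝ ℂ V 1)

/-- `p` is a light-like eigendirection of `φ` with respect to the form `B`. -/
def IsLightlikeEigendirection (B : LinearMap.BilinForm ℝ V) (φ : Module.End ℝ V)
    (p : ℙ ℝ V) : Prop :=
  ∃ (x : V) (hx : x ≠ 0), p = Projectivization.mk ℝ x hx ∧ B x x = 0 ∧
    ∃ μ : ℝ, φ.HasEigenvector μ x

end Module.End

/-- A geometric Coxeter system `(W, S)_B`: a Coxeter system together with a choice of the entries
`-c s t` of `B` for the pairs with `m s t = ∞` (encoded by `M s t = 0`).  The values of `c` at all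
other pairs are irrelevant. -/
structure GeometricCoxeterSystem {S : Type*} (M : CoxeterMatrix S) (W : Type*) [Group W] where
  toCoxeterSystem : CoxeterSystem M W
  c : S → S → ℝ
  c_symm : ∀ s t, M s t = 0 → c s t = c t s
  one_le_c : ∀ s t, M s t = 0 → 1 ≤ c s t

namespace GeometricCoxeterSystem

variable {S : Type*} {M : CoxeterMatrix S} {W : Type*} [Group W]
  (G : GeometricCoxeterSystem M W)

/-- The matrix `B`. -/
def gram : Matrix S S ℝ :=
  Matrix.of fun s t => if M s t = 0 then -G.c s t else -Real.cos (Real.pi / M s t)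

theorem gram_symm (s t : S) : G.gram s t = G.gram t s := by
  simp only [gram, Matrix.of_apply, M.symmetric t s]
  split_ifs with h
  · rw [G.c_symm s t h]
  · rfl

variable [Fintype S] [DecidableEq S]

/-- The bilinear form on `V = ℝ^S` with matrix `B` in the standard basis `Δ`. -/
def form : LinearMap.BilinForm ℝ (S → ℝ) := Matrix.toBilin' G.gram

/-- The simple root `α_s`, a vector of the standard basis. -/
def simpleRoot (_G : GeometricCoxeterSystem M W) (s : S) : S → ℝ := Pi.single s 1

theorem form_simpleRoot (s t : S) :
    G.form (G.simpleRoot s) (G.simpleRoot t) = G.gram s t := by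
  simp [form, simpleRoot]

theorem form_simpleRoot_self (s : S) : G.form (G.simpleRoot s) (G.simpleRoot s) = 1 := by
  simp [form_simpleRoot, gram]

/-- The simple reflection `σ_{α_s}`. -/
def simpleReflection (s : S) : (S → ℝ) ≃ₗ[ℝ] (S → ℝ) :=
  G.form.vectorReflection (G.simpleRoot s) (by simp [form_simpleRoot_self])

theorem chebyshevS_eval_two_cos_mul_sin (θ : ℝ) (n : ℕ) :
    (Polynomial.Chebyshev.S ℝ n).eval (2 * Real.cos θ) * Real.sin θ
      = Real.sin ((n + 1) * θ) := by
  induction n using Nat.twoStepInduction with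
  | zero => simp
  | one =>
    norm_num
    rw [Real.sin_two_mul]; ring
  | more n h1 h2 =>
    push_cast at h2 ⊢
    rw [Polynomial.Chebyshev.S_add_two]
    simp only [Polynomial.eval_sub, Polynomial.eval_mul, Polynomial.eval_X, sub_mul, h1]
    rw [mul_assoc, h2]
    have e1 : ((n : ℝ) + 2 + 1) * θ = (n + 1 + 1) * θ + θ := by ring
    have e2 : ((n : ℝ) + 1) * θ = (n + 1 + 1) * θ - θ := by ring
    rw [e1, e2, Real.sin_add, Real.sin_sub]
    ring

/-- The simple reflections satisfy the Coxeter relations. -/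
theorem simpleReflection_isLiftable : M.IsLiftable G.simpleReflection := by
  intro s t
  rcases eq_or_ne s t with rfl | hst
  · rw [M.diagonal, pow_one]
    apply LinearEquiv.ext
    intro x
    exact Module.involutive_reflection (by simp [form_simpleRoot_self]) x
  rcases Nat.eq_zero_or_pos (M s t) with h0 | hpos
  · rw [h0, pow_zero]
  have h1 := M.off_diagonal s t hst
  have hm2 : 2 ≤ M s t := by omega
  have hg : G.gram s t = -Real.cos (Real.pi / M s t) := by simp [gram, hpos.ne']
  generalize M s t = m at *
  apply LinearEquiv.ext
  intro z
  set f : Module.Dual ℝ (S → ℝ) :=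
    (2 / G.form (G.simpleRoot s) (G.simpleRoot s)) • G.form.flip (G.simpleRoot s) with hf
  set g : Module.Dual ℝ (S → ℝ) :=
    (2 / G.form (G.simpleRoot t) (G.simpleRoot t)) • G.form.flip (G.simpleRoot t) with hgdef
  have hfs : f (G.simpleRoot s) = 2 := by simp [hf, form_simpleRoot_self]
  have hgt : g (G.simpleRoot t) = 2 := by simp [hgdef, form_simpleRoot_self]
  have hft : f (G.simpleRoot t) = -2 * Real.cos (Real.pi / m) := by
    simp [hf, form_simpleRoot_self, form_simpleRoot, G.gram_symm t s, hg]
  have hgs : g (G.simpleRoot s) = -2 * Real.cos (Real.pi / m) := by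
    simp [hgdef, form_simpleRoot_self, form_simpleRoot, hg]
  have hθ : 2 * Real.cos (2 * (Real.pi / m))
      = f (G.simpleRoot t) * g (G.simpleRoot s) - 2 := by
    rw [hft, hgs, Real.cos_two_mul]; ring
  have key := Module.reflection_mul_reflection_pow_apply hfs hgt m z _ hθ
  change ((Module.reflection hfs * Module.reflection hgt) ^ m) z = z
  rw [key]
  have hm0 : (m : ℝ) ≠ 0 := by positivity
  rcases eq_or_ne m 2 with rfl | hm
  · have c0 : Real.cos (Real.pi / (2 : ℕ)) = 0 := by norm_num
    have c1 : Real.cos (2 * (Real.pi / (2 : ℕ))) = -1 := by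
      rw [Nat.cast_ofNat, mul_div_cancel₀ _ (by norm_num : (2 : ℝ) ≠ 0), Real.cos_pi]
    rw [hft, hgs, c0, c1]
    norm_num [Polynomial.Chebyshev.S_zero, Polynomial.Chebyshev.S_one]
    abel
  have hm3 : 3 ≤ m := by omega
  have hsin : Real.sin (2 * (Real.pi / m)) ≠ 0 := by
    apply ne_of_gt
    apply Real.sin_pos_of_pos_of_lt_pi
    · positivity
    · rw [← mul_div_assoc, div_lt_iff₀ (by positivity), mul_comm]
      have : (3 : ℝ) ≤ m := by exact_mod_cast hm3
      nlinarith [Real.pi_pos]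
  set θ := 2 * (Real.pi / m) with hθdef
  have hmθ : (m : ℝ) * θ = 2 * Real.pi := by rw [hθdef]; field_simp
  rcases Nat.even_or_odd' m with ⟨j, hj | hj⟩
  · obtain ⟨i, rfl⟩ : ∃ i, j = i + 1 := ⟨j - 1, by omega⟩
    have e1 : ((m : ℤ) - 2) / 2 = (i : ℤ) := by omega
    have e2 : ((m : ℤ) - 1) / 2 = (i : ℤ) := by omega
    have hz : (Polynomial.Chebyshev.S ℝ (i : ℤ)).eval (2 * Real.cos θ) = 0 := by
      apply (mul_eq_zero.mp _).resolve_right hsin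
      rw [chebyshevS_eval_two_cos_mul_sin]
      have : ((i : ℝ) + 1) * θ = Real.pi := by
        have h2 : (m : ℝ) = 2 * (i + 1) := by rw [hj]; push_cast; ring
        rw [h2] at hmθ; linarith
      rw [this, Real.sin_pi]
    rw [e1, e2, hz]
    simp
  · obtain ⟨i, rfl⟩ : ∃ i, j = i + 1 := ⟨j - 1, by omega⟩
    have e1 : ((m : ℤ) - 2) / 2 = (i : ℤ) := by omega
    have e2 : ((m : ℤ) - 1) / 2 = ((i + 1 : ℕ) : ℤ) := by omega
    have e3 : ((m : ℤ) - 3) / 2 = (i : ℤ) := by omega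
    have e4 : (m : ℤ) / 2 = ((i + 1 : ℕ) : ℤ) := by omega
    have hz : (Polynomial.Chebyshev.S ℝ ((i + 1 : ℕ) : ℤ)).eval (2 * Real.cos θ)
        + (Polynomial.Chebyshev.S ℝ (i : ℤ)).eval (2 * Real.cos θ) = 0 := by
      apply (mul_eq_zero.mp _).resolve_right hsin
      rw [add_mul, chebyshevS_eval_two_cos_mul_sin, chebyshevS_eval_two_cos_mul_sin]
      have : (((i + 1 : ℕ) : ℝ) + 1) * θ = 2 * Real.pi - ((i : ℝ) + 1) * θ := by
        have h2 : (m : ℝ) = 2 * (i + 1) + 1 := by rw [hj]; push_cast; ring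
        rw [h2] at hmθ; push_cast; linarith
      rw [this, Real.sin_two_pi_sub]
      ring
    rw [e1, e2, e3, e4, hz]
    simp

/-- The geometric representation `ρ : W → GL(V)`, sending `s` to `σ_{α_s}`. -/
def rep : W →* ((S → ℝ) ≃ₗ[ℝ] (S → ℝ)) :=
  G.toCoxeterSystem.lift ⟨G.simpleReflection, G.simpleReflection_isLiftable⟩

theorem rep_simple (s : S) : G.rep (G.toCoxeterSystem.simple s) = G.simpleReflection s :=
  G.toCoxeterSystem.lift_apply_simple G.simpleReflection_isLiftable s

/-- `(W, S)_B` is Lorentzian: the form has signature `(n - 1, 1)`, where `n = |S| = dim V`. -/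
def IsLorentzian : Prop := G.form.IsLorentzian

/-- The roots `Φ = W(Δ)`. -/
def roots : Set (S → ℝ) := {γ | ∃ (w : W) (s : S), γ = G.rep w (G.simpleRoot s)}

theorem ne_zero_of_mem_roots {γ : S → ℝ} (h : γ ∈ G.roots) : γ ≠ 0 := by
  obtain ⟨w, s, rfl⟩ := h
  simp [simpleRoot]

/-- The set `E_Φ` of limit roots: limits in the projective space of the directions of injective
sequences of roots. -/
def limitRoots : Set (ℙ ℝ (S → ℝ)) :=
  {p | ∃ (γ : ℕ → S → ℝ) (hγ : ∀ i, γ i ∈ G.roots), Function.Injective γ ∧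
    Filter.Tendsto (fun i => Projectivization.mk ℝ (γ i) (G.ne_zero_of_mem_roots (hγ i)))
      Filter.atTop (𝓝 p)}

/-- The direction `p` is a limit direction arising from the base point `p₀` through the sequence
`g`: the points `g k · p₀` are pairwise distinct and converge to `p`. -/
def IsLimitDirectionThrough (g : ℕ → W) (p₀ p : ℙ ℝ (S → ℝ)) : Prop :=
  Function.Injective (fun k => G.rep (g k) • p₀) ∧
    Filter.Tendsto (fun k => G.rep (g k) • p₀) Filter.atTop (𝓝 p)

/-- The endomorphism of `V` given by `w`. -/
abbrev toEnd (w : W) : Module.End ℝ (S → ℝ) := (G.rep w).toLinearMap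

end GeometricCoxeterSystem

end

/-!
Let `(z, u)` be a Jordan chain of an isometry, `f z = μ z + u` with `f u = μ u`. Comparing
`B (f z) (f v)` with `B z v` for an eigenvector `v` forces `B u v = 0`, so `u` is isotropic and
orthogonal to every eigenvector, and over `ℂ` also to its own conjugate. Since totally isotropic
subspaces are at most one-dimensional, `u` is therefore a multiple of a real vector `x`, its
eigenvalue is a real `ε = ±1`, and every isotropic eigenvector is proportional to `x`; in particular
all eigenvalues other than `ε` are semisimple.

Hence every `y` is a sum of a generalized eigenvector `g` for `ε` and a vector of `U_w`, whose orbit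
is bounded. If `y ∉ U_w`, then `g` is not an eigenvector, so `w ^ k g` grows like `k ^ m` with
`m ≥ 1`, in the direction of the end of a Jordan chain, which is that of `x`. A point whose iterates
converge to a different point has pairwise distinct iterates. Applying this to a simple root outside
`U_w` shows that `x` is a limit root.
-/

section JordanChain

/-- `(z, u)` is the end of a Jordan chain of `f` at the eigenvalue `μ`: the generalized eigenvector
`z` is sent by `f - μ` to the eigenvector `u ≠ 0`. -/
structure IsJordanChain {R E : Type*} [CommRing R] [AddCommGroup E] [Module R E]
    (f : Module.End R E) (μ : R) (z u : E) : Prop where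
  hasEigenvector : f.HasEigenvector μ u
  apply_eq : f z = μ • z + u

variable {R E : Type*} [CommRing R] [AddCommGroup E] [Module R E] {f : Module.End R E} {μ : R}

theorem exists_isJordanChain_of_mem_maxGenEigenspace {v : E} (hv : v ∈ f.maxGenEigenspace μ)
    (hv' : v ∉ f.eigenspace μ) :
    ∃ m, IsJordanChain f μ (((f - μ • 1 : Module.End R E) ^ m) v)
      (((f - μ • 1 : Module.End R E) ^ (m + 1)) v) := by
  have first_ne_zero : ((f - μ • 1 : Module.End R E) ^ (0 + 1)) v ≠ 0 := by
    simpa [Module.End.mem_eigenspace_iff, sub_eq_zero] using hv'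
  obtain ⟨k, hk⟩ := (Module.End.mem_maxGenEigenspace f μ v).1 hv
  have exists_eq_zero : ∃ k, ((f - μ • 1 : Module.End R E) ^ (k + 1)) v = 0 :=
    ⟨k, by rw [pow_succ', Module.End.mul_apply, hk, map_zero]⟩
  obtain ⟨m, ne_zero, succ_eq_zero⟩ :=
    Nat.exists_not_and_succ_of_not_zero_of_exists first_ne_zero exists_eq_zero
  refine ⟨m, ⟨?_, ne_zero⟩, ?_⟩
  · rw [pow_succ', Module.End.mul_apply] at succ_eq_zero
    simpa [Module.End.mem_eigenspace_iff, sub_eq_zero] using succ_eq_zero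
  · rw [pow_succ', Module.End.mul_apply]
    simp

theorem maxGenEigenspace_le_eigenspace (h : ∀ z u, ¬ IsJordanChain f μ z u) :
    f.maxGenEigenspace μ ≤ f.eigenspace μ := fun v hv => by
  by_contra hv'
  obtain ⟨m, chain⟩ := exists_isJordanChain_of_mem_maxGenEigenspace hv hv'
  exact h _ _ chain

theorem span_setOf_hasEigenvector_eq_top {K E : Type*} [Field K] [IsAlgClosed K] [AddCommGroup E]
    [Module K E] [FiniteDimensional K E] {f : Module.End K E}
    (h : ∀ μ z u, ¬ IsJordanChain f μ z u) :
    Submodule.span K {z | ∃ μ, f.HasEigenvector μ z} = ⊤ := by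
  rw [eq_top_iff, ← f.iSup_maxGenEigenspace_eq_top]
  refine iSup_le fun μ z hz => ?_
  obtain rfl | hz0 := eq_or_ne z 0
  · exact zero_mem _
  · exact Submodule.subset_span ⟨μ, maxGenEigenspace_le_eigenspace (h μ) hz, hz0⟩

namespace IsJordanChain

variable {z u : E} [IsDomain R]

theorem smul [Module.IsTorsionFree R E] (h : IsJordanChain f μ z u) {c : R} (hc : c ≠ 0) :
    IsJordanChain f μ (c • z) (c • u) where
  hasEigenvector :=
    ⟨Submodule.smul_mem _ c h.hasEigenvector.1, smul_ne_zero hc h.hasEigenvector.2⟩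
  apply_eq := by rw [map_smul, h.apply_eq, smul_add, smul_comm]

variable {B : LinearMap.BilinForm R E} {v : E} {ν : R}

theorem bilin_right_eq_zero (h : IsJordanChain f μ z u) (hf : B.IsOrthogonal f)
    (hv : f v = ν • v) : B u v = 0 := by
  by_contra huv
  have pair_u := hf u v
  have pair_z := hf z v
  rw [h.hasEigenvector.apply_eq_smul, hv] at pair_u
  rw [h.apply_eq, hv] at pair_z
  simp only [map_add, map_smul, LinearMap.add_apply, LinearMap.smul_apply, smul_eq_mul]
    at pair_u pair_z
  have mul_eq_one : μ * ν = 1 := mul_right_cancel₀ huv (by linear_combination pair_u)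
  have mul_eq_zero : ν * B u v = 0 := by linear_combination pair_z - B z v * mul_eq_one
  exact mul_ne_zero (right_ne_zero_of_mul_eq_one mul_eq_one) huv mul_eq_zero

theorem bilin_left_eq_zero (h : IsJordanChain f μ z u) (hf : B.IsOrthogonal f)
    (hv : f v = ν • v) : B v u = 0 :=
  h.bilin_right_eq_zero (B := B.flip) (fun x y => hf y x) hv

theorem bilin_self_eq_zero (h : IsJordanChain f μ z u) (hf : B.IsOrthogonal f) : B u u = 0 :=
  h.bilin_right_eq_zero hf h.hasEigenvector.apply_eq_smul

end IsJordanChain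

end JordanChain

/-- The totally isotropic subspaces of `B` are at most one-dimensional. This holds for forms of
signature `(n - 1, 1)`, and also for semidefinite forms whose radical is at most
one-dimensional. -/
def HasIsotropyIndexLEOne {K V : Type*} [Field K] [AddCommGroup V] [Module K V]
    (B : LinearMap.BilinForm K V) : Prop :=
  ∀ U : Submodule K V, U ≤ B.orthogonal U → Module.finrank K U ≤ 1

namespace HasIsotropyIndexLEOne

theorem of_isLorentzian {V : Type*} [AddCommGroup V] [Module ℝ V] [FiniteDimensional ℝ V]
    {B : LinearMap.BilinForm ℝ V} (hB : B.IsLorentzian) : HasIsotropyIndexLEOne B := fun U hU => by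
  have sigPos_add_finrank_le := QuadraticForm.sigPos_add_finrank_le_of_nonpos
    (Q := B.toQuadraticMap) (V := U) fun x hx => (hU hx x hx).le
  rw [← hB.1] at sigPos_add_finrank_le
  lia

variable {K V : Type*} [Field K] [AddCommGroup V] [Module K V] {B : LinearMap.BilinForm K V}

theorem exists_eq_smul (hB : HasIsotropyIndexLEOne B) {a b : V} (ha : a ≠ 0) (haa : B a a = 0)
    (hab : B a b = 0) (hba : B b a = 0) (hbb : B b b = 0) : ∃ c : K, b = c • a := by
  have isotropic : Submodule.span K {a, b} ≤ B.orthogonal (Submodule.span K {a, b}) := by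
    intro x hx y hy
    obtain ⟨s, t, rfl⟩ := Submodule.mem_span_pair.1 hx
    obtain ⟨s', t', rfl⟩ := Submodule.mem_span_pair.1 hy
    simp [haa, hab, hba, hbb]
  by_contra! not_smul
  have independent : LinearIndependent K ![a, b] :=
    (LinearIndependent.pair_iff' ha).2 fun c hc => not_smul c hc.symm
  have finrank_eq_two := finrank_span_eq_card independent
  rw [Matrix.range_cons_cons_empty, Fintype.card_fin] at finrank_eq_two
  have finrank_le_one := hB _ isotropic
  lia

variable {f : Module.End K V} {μ ν : K} {z u : V}

theorem exists_eq_smul_of_isJordanChain (hB : HasIsotropyIndexLEOne B) (hf : B.IsOrthogonal f)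
    (h : IsJordanChain f μ z u) {v : V} (hv : f v = ν • v) (hvv : B v v = 0) :
    ∃ c : K, v = c • u :=
  hB.exists_eq_smul h.hasEigenvector.2 (h.bilin_self_eq_zero hf) (h.bilin_right_eq_zero hf hv)
    (h.bilin_left_eq_zero hf hv) hvv

theorem eigenvalue_eq_of_isJordanChain (hB : HasIsotropyIndexLEOne B) (hf : B.IsOrthogonal f)
    (h : IsJordanChain f μ z u) {z' u' : V} (h' : IsJordanChain f ν z' u') : ν = μ := by
  have hu' := h'.hasEigenvector.apply_eq_smul
  obtain ⟨c, rfl⟩ := hB.exists_eq_smul_of_isJordanChain hf h hu' (h'.bilin_self_eq_zero hf)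
  rw [map_smul, h.hasEigenvector.apply_eq_smul, smul_comm] at hu'
  exact (smul_left_injective K h'.hasEigenvector.2 hu').symm

end HasIsotropyIndexLEOne

theorem isLightlikeEigendirection_iff_eq_mk {V : Type*} [AddCommGroup V] [Module ℝ V]
    {B : LinearMap.BilinForm ℝ V} (hB : HasIsotropyIndexLEOne B) {φ : Module.End ℝ V}
    (hφ : B.IsOrthogonal φ) {ε : ℝ} {z x : V} (h : IsJordanChain φ ε z x) {p : ℙ ℝ V} :
    φ.IsLightlikeEigendirection B p ↔ p = Projectivization.mk ℝ x h.hasEigenvector.2 := by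
  constructor
  · rintro ⟨v, hv0, rfl, hvv, μ, hv⟩
    obtain ⟨c, hc⟩ := hB.exists_eq_smul_of_isJordanChain hφ h hv.apply_eq_smul hvv
    exact (Projectivization.mk_eq_mk_iff' ℝ _ _ _ _).2 ⟨c, hc.symm⟩
  · rintro rfl
    exact ⟨x, _, rfl, h.bilin_self_eq_zero hφ, ε, h.hasEigenvector⟩

section Complexification

theorem isOrthogonal_baseChange {R A E : Type*} [CommRing R] [CommRing A] [Algebra R A]
    [AddCommGroup E] [Module R E] {B : LinearMap.BilinForm R E} {f : Module.End R E}
    (hf : B.IsOrthogonal f) : (B.baseChange A).IsOrthogonal (LinearMap.baseChange A f) := by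
  intro z t
  induction z with
  | zero => simp
  | add x y hx hy => simp only [map_add, LinearMap.add_apply, hx, hy]
  | tmul a v =>
    induction t with
    | zero => simp
    | add x y hx hy => simp only [map_add, hx, hy]
    | tmul b w => simp [hf v w]

/-- The real part of vectors of the complexification `ℂ ⊗ V`. -/
noncomputable def tensorRe (V : Type*) [AddCommGroup V] [Module ℝ V] : ℂ ⊗[ℝ] V →ₗ[ℝ] V :=
  (TensorProduct.lid ℝ V).toLinearMap ∘ₗ LinearMap.rTensor V Complex.reLm

/-- Complex conjugation on the complexification `ℂ ⊗ V`. -/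
noncomputable def tensorConj (V : Type*) [AddCommGroup V] [Module ℝ V] : ℂ ⊗[ℝ] V ≃ₗ[ℝ] ℂ ⊗[ℝ] V :=
  LinearEquiv.rTensor V Complex.conjAe.toLinearEquiv

variable {V : Type*} [AddCommGroup V] [Module ℝ V]

@[simp] theorem tensorRe_tmul (c : ℂ) (v : V) : tensorRe V (c ⊗ₜ v) = c.re • v := by
  simp [tensorRe]

@[simp] theorem tensorConj_tmul (c : ℂ) (v : V) :
    tensorConj V (c ⊗ₜ v) = (starRingEnd ℂ c) ⊗ₜ v := by
  simp [tensorConj]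

theorem tensorConj_smul (c : ℂ) (z : ℂ ⊗[ℝ] V) :
    tensorConj V (c • z) = starRingEnd ℂ c • tensorConj V z := by
  induction z with
  | zero => simp
  | tmul d v => simp [TensorProduct.smul_tmul']
  | add x y hx hy => simp only [smul_add, map_add, hx, hy]

theorem one_tmul_tensorRe (z : ℂ ⊗[ℝ] V) :
    (1 : ℂ) ⊗ₜ tensorRe V z = (1 / 2 : ℂ) • (z + tensorConj V z) := by
  induction z with
  | zero => simp
  | tmul c v =>
    rw [tensorRe_tmul, tensorConj_tmul, ← TensorProduct.add_tmul, Complex.add_conj,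
      TensorProduct.smul_tmul', ← TensorProduct.smul_tmul]
    congr 1
    simp
  | add x y hx hy =>
    rw [map_add, map_add, TensorProduct.tmul_add, hx, hy]
    module

theorem exists_eq_one_tmul_add_I_tmul (z : ℂ ⊗[ℝ] V) :
    ∃ a b : V, z = (1 : ℂ) ⊗ₜ a + Complex.I ⊗ₜ b := by
  induction z with
  | zero => exact ⟨0, 0, by simp⟩
  | tmul c v =>
    refine ⟨c.re • v, c.im • v, ?_⟩
    rw [← TensorProduct.smul_tmul, ← TensorProduct.smul_tmul, ← TensorProduct.add_tmul]
    congr 1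
    simp
  | add x y hx hy =>
    obtain ⟨a, b, rfl⟩ := hx
    obtain ⟨a', b', rfl⟩ := hy
    exact ⟨a + a', b + b', by simp only [TensorProduct.tmul_add]; abel⟩

theorem one_tmul_injective : Function.Injective fun v : V => (1 : ℂ) ⊗ₜ[ℝ] v :=
  Function.LeftInverse.injective (g := tensorRe V) fun v => by simp

theorem ofReal_smul_one_tmul (a : ℝ) (v : V) :
    (a : ℂ) • ((1 : ℂ) ⊗ₜ[ℝ] v) = (1 : ℂ) ⊗ₜ[ℝ] (a • v) := by
  rw [TensorProduct.tmul_smul]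
  rfl

theorem HasIsotropyIndexLEOne.exists_eq_tmul {B : LinearMap.BilinForm ℝ V}
    (hB : HasIsotropyIndexLEOne B) {u : ℂ ⊗[ℝ] V} (huu : B.baseChange ℂ u u = 0)
    (hu_conj : B.baseChange ℂ u (tensorConj V u) = 0) : ∃ (c : ℂ) (x : V), u = c ⊗ₜ x := by
  obtain ⟨a, b, rfl⟩ := exists_eq_one_tmul_add_I_tmul u
  obtain rfl | ha := eq_or_ne a 0
  · exact ⟨Complex.I, b, by simp⟩
  have re_im : B a a - B b b = 0 ∧ B a b + B b a = 0 := by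
    simpa [Complex.ext_iff, sub_eq_add_neg] using huu
  have re_im_conj : B a a + B b b = 0 ∧ -B a b + B b a = 0 := by
    simpa [Complex.ext_iff] using hu_conj
  obtain ⟨c, rfl⟩ := hB.exists_eq_smul (b := b) ha (by linarith) (by linarith) (by linarith)
    (by linarith)
  refine ⟨1 + c * Complex.I, a, ?_⟩
  rw [TensorProduct.add_tmul, ← TensorProduct.smul_tmul, Complex.real_smul]

theorem tensorRe_complexify (φ : Module.End ℝ V) (z : ℂ ⊗[ℝ] V) :
    tensorRe V (φ.complexify z) = φ (tensorRe V z) := by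
  induction z with
  | zero => simp
  | tmul d v => simp
  | add x y hx hy => simp only [map_add, hx, hy]

theorem tensorRe_complexify_pow (φ : Module.End ℝ V) (k : ℕ) (z : ℂ ⊗[ℝ] V) :
    tensorRe V ((φ.complexify ^ k) z) = (φ ^ k) (tensorRe V z) := by
  rw [Module.End.pow_apply, Module.End.pow_apply]
  exact Function.Semiconj.iterate_right (tensorRe_complexify φ) k z

theorem tensorConj_complexify (φ : Module.End ℝ V) (z : ℂ ⊗[ℝ] V) :
    tensorConj V (φ.complexify z) = φ.complexify (tensorConj V z) := by
  induction z with
  | zero => simp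
  | tmul d v => simp
  | add x y hx hy => simp only [map_add, hx, hy]

variable {φ : Module.End ℝ V}

theorem hasEigenvector_tensorConj {μ : ℂ} {z : ℂ ⊗[ℝ] V}
    (hz : φ.complexify.HasEigenvector μ z) :
    φ.complexify.HasEigenvector (starRingEnd ℂ μ) (tensorConj V z) := by
  refine ⟨?_, by simpa using hz.2⟩
  rw [Module.End.mem_eigenspace_iff, ← tensorConj_complexify, hz.apply_eq_smul, tensorConj_smul]

theorem hasEigenvector_one_tmul_iff {ε : ℝ} {v : V} :
    φ.complexify.HasEigenvector (ε : ℂ) (1 ⊗ₜ v) ↔ φ.HasEigenvector ε v := by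
  rw [Module.End.hasEigenvector_iff, Module.End.hasEigenvector_iff, Module.End.mem_eigenspace_iff,
    Module.End.mem_eigenspace_iff, LinearMap.baseChange_tmul, ofReal_smul_one_tmul,
    one_tmul_injective.eq_iff, ← TensorProduct.tmul_zero V (1 : ℂ), one_tmul_injective.ne_iff]

theorem exists_eq_ofReal_of_hasEigenvector_one_tmul {μ : ℂ} {v : V}
    (h : φ.complexify.HasEigenvector μ (1 ⊗ₜ v)) : ∃ ε : ℝ, μ = ε := by
  have conj_h : φ.complexify.HasEigenvector (starRingEnd ℂ μ) (1 ⊗ₜ v) := by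
    simpa using hasEigenvector_tensorConj h
  exact Complex.conj_eq_iff_real.1 <| smul_left_injective ℂ h.2 <|
    conj_h.apply_eq_smul.symm.trans h.apply_eq_smul

theorem IsJordanChain.exists_real {B : LinearMap.BilinForm ℝ V} (hB : HasIsotropyIndexLEOne B)
    (hφ : B.IsOrthogonal φ) {μ : ℂ} {z u : ℂ ⊗[ℝ] V} (h : IsJordanChain φ.complexify μ z u) :
    ∃ (ε : ℝ) (y x : V), μ = ε ∧ IsJordanChain φ ε y x := by
  have hφ_complex := isOrthogonal_baseChange (A := ℂ) hφ
  obtain ⟨c, x, rfl⟩ := hB.exists_eq_tmul (h.bilin_self_eq_zero hφ_complex)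
    (h.bilin_right_eq_zero hφ_complex (hasEigenvector_tensorConj h.hasEigenvector).apply_eq_smul)
  have hc : c ≠ 0 := by
    rintro rfl
    exact h.hasEigenvector.2 (TensorProduct.zero_tmul ..)
  have scaled : IsJordanChain φ.complexify μ (c⁻¹ • z) (1 ⊗ₜ x) := by
    simpa [TensorProduct.smul_tmul', hc] using h.smul (inv_ne_zero hc)
  obtain ⟨ε, rfl⟩ := exists_eq_ofReal_of_hasEigenvector_one_tmul scaled.hasEigenvector
  refine ⟨ε, tensorRe V (c⁻¹ • z), x, rfl, hasEigenvector_one_tmul_iff.1 scaled.hasEigenvector, ?_⟩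
  rw [← tensorRe_complexify, scaled.apply_eq, map_add, Complex.coe_smul, map_smul, tensorRe_tmul,
    Complex.one_re, one_smul]

theorem tensorRe_mem_maxGenEigenspace {ε : ℝ} {z : ℂ ⊗[ℝ] V}
    (hz : z ∈ φ.complexify.maxGenEigenspace (ε : ℂ)) : tensorRe V z ∈ φ.maxGenEigenspace ε := by
  have complexify_sub : φ.complexify - (ε : ℂ) • (1 : Module.End ℂ (ℂ ⊗[ℝ] V)) =
      (φ - ε • (1 : Module.End ℝ V)).complexify := by
    rw [Module.End.complexify, Module.End.complexify, LinearMap.baseChange_sub,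
      LinearMap.baseChange_smul, LinearMap.baseChange_one]
    rfl
  obtain ⟨k, hk⟩ := (Module.End.mem_maxGenEigenspace _ _ _).1 hz
  refine (Module.End.mem_maxGenEigenspace _ _ _).2 ⟨k, ?_⟩
  rw [← tensorRe_complexify_pow, ← complexify_sub, hk, map_zero]

end Complexification

section UnimodularSubspace

variable {V : Type*} [AddCommGroup V] [Module ℝ V] {φ : Module.End ℝ V}

/-- The complex span of the unimodular eigenvectors of `φ`, whose real vectors form
`φ.unimodularSubspace`. -/
noncomputable def unimodularSpan (φ : Module.End ℝ V) : Submodule ℂ (ℂ ⊗[ℝ] V) :=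
  Submodule.span ℂ {z | ∃ μ : ℂ, ‖μ‖ = 1 ∧ φ.complexify.HasEigenvector μ z}

theorem mem_unimodularSubspace_iff {v : V} :
    v ∈ φ.unimodularSubspace ↔ 1 ⊗ₜ v ∈ unimodularSpan φ :=
  Iff.rfl

theorem eigenspace_le_unimodularSpan {μ : ℂ} (hμ : ‖μ‖ = 1) :
    φ.complexify.eigenspace μ ≤ unimodularSpan φ := fun z hz => by
  obtain rfl | hz0 := eq_or_ne z 0
  · exact zero_mem _
  · exact Submodule.subset_span ⟨μ, hμ, hz, hz0⟩

theorem eigenspace_le_unimodularSubspace {ε : ℝ} (hε : |ε| = 1) :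
    φ.eigenspace ε ≤ φ.unimodularSubspace := fun v hv => by
  refine mem_unimodularSubspace_iff.2 (eigenspace_le_unimodularSpan (μ := ε) (by simpa) ?_)
  rw [Module.End.mem_eigenspace_iff] at hv ⊢
  rw [LinearMap.baseChange_tmul, hv, ofReal_smul_one_tmul]

theorem tensorConj_mem_unimodularSpan {z : ℂ ⊗[ℝ] V} (hz : z ∈ unimodularSpan φ) :
    tensorConj V z ∈ unimodularSpan φ := by
  induction hz using Submodule.span_induction with
  | mem z hz =>
    obtain ⟨μ, hμ, hz⟩ := hz
    exact Submodule.subset_span ⟨_, by simpa, hasEigenvector_tensorConj hz⟩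
  | zero => simp
  | add a b _ _ ha hb => simpa only [map_add] using add_mem ha hb
  | smul c a _ ha => simpa only [tensorConj_smul] using Submodule.smul_mem _ _ ha

theorem tensorRe_mem_unimodularSubspace {z : ℂ ⊗[ℝ] V} (hz : z ∈ unimodularSpan φ) :
    tensorRe V z ∈ φ.unimodularSubspace := by
  rw [mem_unimodularSubspace_iff, one_tmul_tensorRe]
  exact Submodule.smul_mem _ _ (add_mem hz (tensorConj_mem_unimodularSpan hz))

theorem unimodularSubspace_ne_top (hφ : ¬ φ.IsComplexDiagonalizable) :
    φ.unimodularSubspace ≠ ⊤ := fun h_top => by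
  have unimodularSpan_eq_top : unimodularSpan φ = ⊤ := by
    refine eq_top_iff.2 fun z _ => ?_
    obtain ⟨a, b, rfl⟩ := exists_eq_one_tmul_add_I_tmul z
    have one_tmul_mem (v : V) : 1 ⊗ₜ v ∈ unimodularSpan φ :=
      mem_unimodularSubspace_iff.1 (h_top ▸ Submodule.mem_top)
    refine add_mem (one_tmul_mem a) ?_
    simpa [TensorProduct.smul_tmul'] using Submodule.smul_mem _ Complex.I (one_tmul_mem b)
  refine hφ (top_unique (unimodularSpan_eq_top.ge.trans (Submodule.span_mono ?_)))
  exact fun z ⟨μ, _, hz⟩ => ⟨μ, hz⟩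

end UnimodularSubspace

section Parabolic

variable {V : Type*} [AddCommGroup V] [Module ℝ V] {B : LinearMap.BilinForm ℝ V}
  {φ : Module.End ℝ V}

theorem maxGenEigenspace_complexify_le_unimodularSpan (hB : HasIsotropyIndexLEOne B)
    (hφ : B.IsOrthogonal φ) (hunit : ∀ μ, φ.complexify.HasEigenvalue μ → ‖μ‖ = 1)
    {ε : ℝ} {z x : V} (h : IsJordanChain φ ε z x) {μ : ℂ} (hμ : μ ≠ ε) :
    φ.complexify.maxGenEigenspace μ ≤ unimodularSpan φ := by
  have semisimple : φ.complexify.maxGenEigenspace μ ≤ φ.complexify.eigenspace μ := by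
    refine maxGenEigenspace_le_eigenspace fun z u complex_chain => ?_
    obtain ⟨ν, z', x', rfl, real_chain⟩ := complex_chain.exists_real hB hφ
    exact hμ (congrArg _ (hB.eigenvalue_eq_of_isJordanChain hφ h real_chain))
  intro z hz
  obtain rfl | hz0 := eq_or_ne z 0
  · exact zero_mem _
  · have norm_eq_one : ‖μ‖ = 1 :=
      hunit μ (Module.End.hasEigenvalue_of_hasEigenvector ⟨semisimple hz, hz0⟩)
    exact eigenspace_le_unimodularSpan norm_eq_one (semisimple hz)

variable [FiniteDimensional ℝ V]

theorem exists_isJordanChain_of_isParabolic (hB : HasIsotropyIndexLEOne B) (hφ : B.IsOrthogonal φ)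
    (hpar : φ.IsParabolic) : ∃ (ε : ℝ) (z x : V), |ε| = 1 ∧ IsJordanChain φ ε z x := by
  obtain ⟨μ, z, u, chain⟩ : ∃ μ z u, IsJordanChain φ.complexify μ z u := by
    by_contra! no_chain
    exact hpar.2 (span_setOf_hasEigenvector_eq_top no_chain)
  have norm_eq_one := hpar.1 μ (Module.End.hasEigenvalue_of_hasEigenvector chain.hasEigenvector)
  obtain ⟨ε, z, x, rfl, real_chain⟩ := chain.exists_real hB hφ
  exact ⟨ε, z, x, by simpa using norm_eq_one, real_chain⟩

theorem maxGenEigenspace_sup_unimodularSubspace_eq_top (hB : HasIsotropyIndexLEOne B)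
    (hφ : B.IsOrthogonal φ) (hunit : ∀ μ, φ.complexify.HasEigenvalue μ → ‖μ‖ = 1)
    {ε : ℝ} {z x : V} (h : IsJordanChain φ ε z x) :
    φ.maxGenEigenspace ε ⊔ φ.unimodularSubspace = ⊤ := by
  have tensorRe_mem (t : ℂ ⊗[ℝ] V) :
      tensorRe V t ∈ φ.maxGenEigenspace ε ⊔ φ.unimodularSubspace := by
    have ht : t ∈ ⨆ μ, φ.complexify.maxGenEigenspace μ := by
      rw [Module.End.iSup_maxGenEigenspace_eq_top]
      trivial
    induction ht using Submodule.iSup_induction' with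
    | zero => simp
    | add a b _ _ ha hb => simpa only [map_add] using add_mem ha hb
    | mem μ t ht =>
      obtain rfl | hμ := eq_or_ne μ ε
      · exact Submodule.mem_sup_left (tensorRe_mem_maxGenEigenspace ht)
      · exact Submodule.mem_sup_right <| tensorRe_mem_unimodularSubspace <|
          maxGenEigenspace_complexify_le_unimodularSpan hB hφ hunit h hμ ht
  exact eq_top_iff.2 fun v _ => by simpa using tensorRe_mem (1 ⊗ₜ v)

end Parabolic

section Asymptotics

open Filter

theorem tendsto_choose_div_choose_zero {j m : ℕ} (hjm : j < m) :
    Tendsto (fun k : ℕ => (k.choose j : ℝ) / k.choose m) atTop (𝓝 0) := by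
  have pow_isLittleO : (fun k : ℕ => (k : ℝ) ^ j) =o[atTop] (fun k : ℕ => (k : ℝ) ^ m) :=
    (Asymptotics.isLittleO_pow_pow_atTop_of_lt (𝕜 := ℝ) hjm).comp_tendsto
      tendsto_natCast_atTop_atTop
  exact (((isTheta_choose j).trans_isLittleO pow_isLittleO).trans_isTheta
    (isTheta_choose m).symm).tendsto_div_nhds_zero

theorem pow_apply_eq_sum_choose {R E : Type*} [CommRing R] [AddCommGroup E] [Module R E]
    {f : Module.End R E} {μ : R} {g : E} {m k : ℕ}
    (hg : ((f - μ • 1 : Module.End R E) ^ (m + 1)) g = 0) (hmk : m ≤ k) :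
    (f ^ k) g = ∑ j ∈ Finset.range (m + 1),
      ((k.choose j : R) * μ ^ (k - j)) • ((f - μ • 1 : Module.End R E) ^ j) g := by
  set N : Module.End R E := f - μ • 1 with hN
  have f_eq : f = N + algebraMap R _ μ := by rw [hN, Algebra.algebraMap_eq_smul_one, sub_add_cancel]
  have N_pow_eq_zero (j : ℕ) (hj : m + 1 ≤ j) : (N ^ j) g = 0 := by
    rw [← Nat.sub_add_cancel hj, pow_add, Module.End.mul_apply, hg, map_zero]
  have binomial : (f ^ k) g =
      ∑ j ∈ Finset.range (k + 1), ((k.choose j : R) * μ ^ (k - j)) • (N ^ j) g := by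
    rw [f_eq, (Algebra.commute_algebraMap_right μ N).add_pow, LinearMap.sum_apply]
    refine Finset.sum_congr rfl fun j _ => ?_
    rw [← map_pow, ← Algebra.commutes, ← map_natCast (algebraMap R (Module.End R E)),
      ← Algebra.commutes, ← mul_assoc, ← map_mul, Module.End.mul_apply,
      Module.algebraMap_end_apply]
  rw [binomial]
  refine (Finset.sum_subset (Finset.range_mono (by lia)) fun j _ hj => ?_).symm
  rw [N_pow_eq_zero j (by simpa using hj), smul_zero]

section JordanChainGrowth

variable {V : Type*} [AddCommGroup V] [Module ℝ V] [TopologicalSpace V] [IsTopologicalAddGroup V]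
  [ContinuousSMul ℝ V] {φ : Module.End ℝ V}

theorem tendsto_inv_choose_smul_pow_apply {μ : ℝ} (hμ : μ ≠ 0) {g : V} {m : ℕ}
    (hg : ((φ - μ • 1 : Module.End ℝ V) ^ (m + 1)) g = 0) :
    Tendsto (fun k : ℕ => ((k.choose m : ℝ) * μ ^ (k - m))⁻¹ • (φ ^ k) g) atTop
      (𝓝 (((φ - μ • 1 : Module.End ℝ V) ^ m) g)) := by
  set N : Module.End ℝ V := φ - μ • 1
  have lower_terms : ∀ j ∈ Finset.range m, Tendsto
      (fun k : ℕ => ((k.choose j : ℝ) / k.choose m * μ ^ (m - j)) • (N ^ j) g) atTop (𝓝 0) :=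
    fun j hj => by
      simpa using ((tendsto_choose_div_choose_zero (Finset.mem_range.1 hj)).mul_const
        (μ ^ (m - j))).smul_const ((N ^ j) g)
  have tendsto_sum := (tendsto_finsetSum _ lower_terms).add (tendsto_const_nhds (x := (N ^ m) g))
  rw [Finset.sum_const_zero, zero_add] at tendsto_sum
  refine tendsto_sum.congr' ?_
  filter_upwards [eventually_ge_atTop m] with k hk
  have choose_ne_zero : (k.choose m : ℝ) ≠ 0 := by exact_mod_cast (Nat.choose_pos hk).ne'
  rw [pow_apply_eq_sum_choose hg hk, Finset.sum_range_succ, smul_add,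
    inv_smul_smul₀ (mul_ne_zero choose_ne_zero (pow_ne_zero _ hμ)), Finset.smul_sum]
  congr 1
  refine Finset.sum_congr rfl fun j hj => ?_
  have pow_split : μ ^ (k - j) = μ ^ (m - j) * μ ^ (k - m) := by
    rw [← pow_add]
    congr 1
    have := Finset.mem_range.1 hj
    lia
  rw [smul_smul, pow_split]
  congr 1
  field_simp

theorem tendsto_smul_pow_apply_zero_of_mem_unimodularSubspace {v : V}
    (hv : v ∈ φ.unimodularSubspace) {c : ℕ → ℝ} (hc : Tendsto c atTop (𝓝 0)) :
    Tendsto (fun k => c k • (φ ^ k) v) atTop (𝓝 0) := by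
  have complex_orbit {z : ℂ ⊗[ℝ] V} (hz : z ∈ unimodularSpan φ) : ∀ a : ℕ → ℂ,
      Tendsto a atTop (𝓝 0) →
        Tendsto (fun k => tensorRe V (a k • (φ.complexify ^ k) z)) atTop (𝓝 0) := by
    induction hz using Submodule.span_induction with
    | zero => simp [tendsto_const_nhds]
    | add z t _ _ hz ht =>
      intro a ha
      simpa only [map_add, smul_add, add_zero] using (hz a ha).add (ht a ha)
    | smul b z _ hz =>
      intro a ha
      simpa only [map_smul, smul_smul] using hz _ (by simpa using ha.mul_const b)
    | mem z hz =>
      intro a ha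
      obtain ⟨μ, hμ, hz⟩ := hz
      have scalars_tendsto : Tendsto (fun k => a k * μ ^ k) atTop (𝓝 0) := by
        rw [tendsto_zero_iff_norm_tendsto_zero] at ha ⊢
        simpa [hμ] using ha
      let line : ℂ →ₗ[ℝ] V := tensorRe V ∘ₗ (LinearMap.toSpanSingleton ℂ _ z).restrictScalars ℝ
      have line_tendsto := (line.continuous_of_finiteDimensional.tendsto 0).comp scalars_tendsto
      simpa [line, Function.comp_def, hz.pow_apply, smul_smul] using line_tendsto
  have real_orbit := complex_orbit (mem_unimodularSubspace_iff.1 hv) (fun k => (c k : ℂ))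
    ((Complex.continuous_ofReal.tendsto' 0 0 Complex.ofReal_zero).comp hc)
  refine real_orbit.congr fun k => ?_
  rw [Complex.coe_smul, map_smul, tensorRe_complexify_pow, tensorRe_tmul, Complex.one_re, one_smul]

end JordanChainGrowth

theorem exists_isJordanChain_tendsto_smul_pow_apply {V : Type*} [AddCommGroup V] [Module ℝ V]
    [TopologicalSpace V] [IsTopologicalAddGroup V] [ContinuousSMul ℝ V] {φ : Module.End ℝ V} {ε : ℝ}
    (hε : |ε| = 1) (hsup : φ.maxGenEigenspace ε ⊔ φ.unimodularSubspace = ⊤) {y : V}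
    (hy : y ∉ φ.unimodularSubspace) :
    ∃ (z u : V) (c : ℕ → ℝ), IsJordanChain φ ε z u ∧ (∀ᶠ k in atTop, c k ≠ 0) ∧
      Tendsto (fun k => c k • (φ ^ k) y) atTop (𝓝 u) := by
  obtain ⟨g, hg, r, hr, rfl⟩ := Submodule.mem_sup.1 (hsup.ge (Submodule.mem_top (x := y)))
  have hg_not_eigen : g ∉ φ.eigenspace ε := fun h =>
    hy (add_mem (eigenspace_le_unimodularSubspace hε h) hr)
  obtain ⟨m, chain⟩ := exists_isJordanChain_of_mem_maxGenEigenspace hg hg_not_eigen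
  have hε0 : ε ≠ 0 := by
    rintro rfl
    simp at hε
  have pow_apply_eq_zero : ((φ - ε • 1 : Module.End ℝ V) ^ (m + 1 + 1)) g = 0 := by
    rw [pow_succ', Module.End.mul_apply]
    simp [chain.hasEigenvector.apply_eq_smul]
  refine ⟨_, _, fun k => ((k.choose (m + 1) : ℝ) * ε ^ (k - (m + 1)))⁻¹, chain, ?_, ?_⟩
  · filter_upwards [eventually_ge_atTop (m + 1)] with k hk
    have : (k.choose (m + 1) : ℝ) ≠ 0 := by exact_mod_cast (Nat.choose_pos hk).ne'
    positivity
  · have scalars_tendsto : Tendsto (fun k : ℕ => ((k.choose (m + 1) : ℝ) * ε ^ (k - (m + 1)))⁻¹)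
        atTop (𝓝 0) := by
      rw [tendsto_zero_iff_norm_tendsto_zero]
      simpa [hε] using tendsto_choose_div_choose_zero m.succ_pos
    simpa only [map_add, smul_add, add_zero] using
      (tendsto_inv_choose_smul_pow_apply hε0 pow_apply_eq_zero).add
        (tendsto_smul_pow_apply_zero_of_mem_unimodularSubspace hr scalars_tendsto)

end Asymptotics

section ProjectiveDynamics

open Filter

variable {V : Type*} [AddCommGroup V] [Module ℝ V] [TopologicalSpace V]

theorem tendsto_mk_of_tendsto_smul {α : Type*} {l : Filter α} {v : α → V} (hv : ∀ i, v i ≠ 0)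
    {c : α → ℝ} (hc : ∀ᶠ i in l, c i ≠ 0) {x : V} (hx : x ≠ 0)
    (h : Tendsto (fun i => c i • v i) l (𝓝 x)) :
    Tendsto (fun i => Projectivization.mk ℝ (v i) (hv i)) l (𝓝 (Projectivization.mk ℝ x hx)) := by
  classical
  let u : α → {v : V // v ≠ 0} := fun i =>
    if hi : c i = 0 then ⟨x, hx⟩ else ⟨c i • v i, smul_ne_zero hi (hv i)⟩
  have hu : Tendsto u l (𝓝 ⟨x, hx⟩) := by
    rw [tendsto_subtype_rng]
    refine h.congr' ?_
    filter_upwards [hc] with i hi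
    simp [u, hi]
  have continuous_mk' : Continuous (Projectivization.mk' ℝ : {v : V // v ≠ 0} → ℙ ℝ V) :=
    continuous_coinduced_rng
  refine ((continuous_mk'.tendsto _).comp hu).congr' ?_
  filter_upwards [hc] with i hi
  simp only [u, hi, Function.comp_apply, dif_neg, not_false_eq_true, Projectivization.mk'_eq_mk]
  exact (Projectivization.mk_eq_mk_iff' ℝ _ _ _ _).2 ⟨c i, rfl⟩

instance t1Space_projectivization [IsTopologicalAddGroup V] [ContinuousSMul ℝ V] [T2Space V] :
    T1Space (ℙ ℝ V) where
  t1 p := by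
    induction p using Projectivization.ind with
    | h x hx =>
      have preimage_eq : (Projectivization.mk' ℝ : {v : V // v ≠ 0} → ℙ ℝ V) ⁻¹'
          {Projectivization.mk ℝ x hx} = Subtype.val ⁻¹' (Submodule.span ℝ {x} : Set V) := by
        ext v
        simp [Projectivization.mk'_eq_mk, Projectivization.mk_eq_mk_iff',
          Submodule.mem_span_singleton]
      rw [isClosed_coinduced, preimage_eq]
      exact (Submodule.closed_of_finiteDimensional _).preimage continuous_subtype_val

theorem injective_iterate_of_tendsto {X : Type*} [TopologicalSpace X] [T1Space X] {f : X → X}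
    (hf : Function.Injective f) {x y : X} (h : Tendsto (fun k => f^[k] x) atTop (𝓝 y))
    (hxy : x ≠ y) : Function.Injective fun k => f^[k] x := by
  refine Function.Injective.of_lt_imp_ne fun k l hkl heq => hxy ?_
  have periodic : Function.IsPeriodicPt f (l - k) x := Function.iterate_cancel hf heq.symm
  have along_period : Tendsto (fun n => f^[(l - k) * n] x) atTop (𝓝 y) :=
    h.comp (tendsto_id.const_mul_atTop' (Nat.sub_pos_of_lt hkl))
  simp only [(periodic.mul_const _).eq] at along_period
  exact tendsto_const_nhds_iff.1 along_period

variable [IsTopologicalAddGroup V] [ContinuousSMul ℝ V] [T2Space V] [FiniteDimensional ℝ V]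

theorem injective_and_tendsto_pow_smul_mk {B : LinearMap.BilinForm ℝ V}
    (hB : HasIsotropyIndexLEOne B) {g : V ≃ₗ[ℝ] V} (hg : B.IsOrthogonal g.toLinearMap)
    (hpar : Module.End.IsParabolic g.toLinearMap) {p : ℙ ℝ V}
    (hp : Module.End.IsLightlikeEigendirection B g.toLinearMap p) {y : V} (hy : y ≠ 0)
    (hyU : y ∉ Module.End.unimodularSubspace g.toLinearMap) :
    Function.Injective (fun k : ℕ => g ^ k • Projectivization.mk ℝ y hy) ∧
      Tendsto (fun k : ℕ => g ^ k • Projectivization.mk ℝ y hy) atTop (𝓝 p) := by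
  obtain ⟨ε, z, x, hε, chain⟩ := exists_isJordanChain_of_isParabolic hB hg hpar
  obtain ⟨z', u, c, chain', hc, tendsto_u⟩ := exists_isJordanChain_tendsto_smul_pow_apply hε
    (maxGenEigenspace_sup_unimodularSubspace_eq_top hB hg hpar.1 chain) hyU
  obtain rfl := (isLightlikeEigendirection_iff_eq_mk hB hg chain').1 hp
  have tendsto_mk : Tendsto (fun k : ℕ => g ^ k • Projectivization.mk ℝ y hy) atTop
      (𝓝 (Projectivization.mk ℝ u chain'.hasEigenvector.2)) := by
    refine tendsto_mk_of_tendsto_smul (fun k => (g ^ k).map_ne_zero_iff.2 hy) hc _ ?_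
    simpa only [LinearEquiv.coe_pow, Module.End.coe_pow, LinearEquiv.coe_coe] using tendsto_u
  have mk_ne : Projectivization.mk ℝ y hy ≠ Projectivization.mk ℝ u chain'.hasEigenvector.2 := by
    intro heq
    obtain ⟨a, rfl⟩ := (Projectivization.mk_eq_mk_iff' ℝ _ _ _ _).1 heq
    exact hyU (Submodule.smul_mem _ a
      (eigenspace_le_unimodularSubspace hε chain'.hasEigenvector.1))
  simp only [← smul_iterate_apply] at tendsto_mk ⊢
  exact ⟨injective_iterate_of_tendsto (MulAction.injective g) tendsto_mk mk_ne, tendsto_mk⟩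

end ProjectiveDynamics

namespace GeometricCoxeterSystem

variable {S : Type*} {M : CoxeterMatrix S} {W : Type*} [Group W] (G : GeometricCoxeterSystem M W)
  [DecidableEq S]

theorem exists_simpleRoot_notMem [Finite S] {U : Submodule ℝ (S → ℝ)} (hU : U ≠ ⊤) :
    ∃ s, G.simpleRoot s ∉ U := by
  have := Fintype.ofFinite S
  by_contra! simpleRoot_mem
  refine hU (top_unique ?_)
  rw [← (Pi.basisFun ℝ S).span_eq, Submodule.span_le]
  rintro _ ⟨s, rfl⟩
  simpa [simpleRoot] using simpleRoot_mem s

variable [Fintype S]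

theorem form_comm (u v : S → ℝ) : G.form u v = G.form v u := by
  have gram_transpose : G.gram.transpose = G.gram := Matrix.ext fun s t => G.gram_symm t s
  rw [form, Matrix.toBilin'_apply', Matrix.toBilin'_apply', Matrix.dotProduct_mulVec,
    ← Matrix.mulVec_transpose, gram_transpose, dotProduct_comm]

theorem isOrthogonal_rep (w : W) : G.form.IsOrthogonal (G.rep w) := by
  induction w using G.toCoxeterSystem.simple_induction with
  | one => simp [LinearMap.IsOrthogonal]
  | mul w w' h h' =>
    intro u v
    rw [map_mul, LinearEquiv.mul_apply, LinearEquiv.mul_apply, h, h']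
  | simple s =>
    intro u v
    rw [rep_simple, simpleReflection, LinearMap.BilinForm.vectorReflection_apply,
      LinearMap.BilinForm.vectorReflection_apply]
    simp only [form_simpleRoot_self, map_sub, map_smul, LinearMap.sub_apply, LinearMap.smul_apply,
      smul_eq_mul, G.form_comm (G.simpleRoot s) v]
    ring

theorem mem_limitRoots_of_isLimitDirectionThrough {g : ℕ → W} {γ : S → ℝ} (hγ : γ ∈ G.roots)
    {p : ℙ ℝ (S → ℝ)}
    (h : G.IsLimitDirectionThrough g (Projectivization.mk ℝ γ (G.ne_zero_of_mem_roots hγ)) p) :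
    p ∈ G.limitRoots := by
  have orbit_mem_roots (k : ℕ) : G.rep (g k) γ ∈ G.roots := by
    obtain ⟨w, s, rfl⟩ := hγ
    exact ⟨g k * w, s, by rw [map_mul, LinearEquiv.mul_apply]⟩
  refine ⟨fun k => G.rep (g k) γ, orbit_mem_roots, fun k l hkl => h.1 ?_, h.2⟩
  simp only [Projectivization.smul_mk]
  congr 1

theorem simpleRoot_mem_roots (s : S) : G.simpleRoot s ∈ G.roots :=
  ⟨1, s, by simp⟩

theorem isLimitDirectionThrough_pow (hG : HasIsotropyIndexLEOne G.form) {w : W}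
    (hw : (G.toEnd w).IsParabolic) {p : ℙ ℝ (S → ℝ)}
    (hp : (G.toEnd w).IsLightlikeEigendirection G.form p) {y : S → ℝ} (hy : y ≠ 0)
    (hyU : y ∉ (G.toEnd w).unimodularSubspace) :
    G.IsLimitDirectionThrough (fun k => w ^ k) (Projectivization.mk ℝ y hy) p := by
  simpa only [IsLimitDirectionThrough, map_pow] using
    injective_and_tendsto_pow_smul_mk hG (G.isOrthogonal_rep w) hw hp hy hyU

end GeometricCoxeterSystem

theorem mainTheorem6_general {S : Type*} [Fintype S] [DecidableEq S] {M : CoxeterMatrix S}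
    {W : Type*} [Group W] (G : GeometricCoxeterSystem M W) (hG : HasIsotropyIndexLEOne G.form)
    (w : W) (hw : (G.toEnd w).IsParabolic) :
    (∃! p : ℙ ℝ (S → ℝ), (G.toEnd w).IsLightlikeEigendirection G.form p) ∧
    ∀ p : ℙ ℝ (S → ℝ), (G.toEnd w).IsLightlikeEigendirection G.form p →
      p ∈ G.limitRoots ∧
      ∀ (y : S → ℝ) (hy : y ≠ 0), y ∉ (G.toEnd w).unimodularSubspace →
        G.IsLimitDirectionThrough (fun k => w ^ k) (Projectivization.mk ℝ y hy) p := by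
  have horth : G.form.IsOrthogonal (G.toEnd w) := G.isOrthogonal_rep w
  obtain ⟨ε, z, x, -, chain⟩ := exists_isJordanChain_of_isParabolic hG horth hw
  have lightlike_iff {p} := isLightlikeEigendirection_iff_eq_mk hG horth chain (p := p)
  obtain ⟨s, hs⟩ := G.exists_simpleRoot_notMem (unimodularSubspace_ne_top hw.2)
  refine ⟨⟨_, lightlike_iff.2 rfl, fun q => lightlike_iff.1⟩, fun p hp => ⟨?_, ?_⟩⟩
  · exact G.mem_limitRoots_of_isLimitDirectionThrough (G.simpleRoot_mem_roots s)
      (G.isLimitDirectionThrough_pow hG hw hp _ hs)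
  · exact fun y hy hyU => G.isLimitDirectionThrough_pow hG hw hp hy hyU

theorem mainTheorem6 {S : Type*} [Fintype S] [DecidableEq S] {M : CoxeterMatrix S}
    {W : Type*} [Group W] (G : GeometricCoxeterSystem M W) (hG : G.IsLorentzian)
    (w : W) (hw : (G.toEnd w).IsParabolic) :
    (∃! p : ℙ ℝ (S → ℝ), (G.toEnd w).IsLightlikeEigendirection G.form p) ∧
    ∀ p : ℙ ℝ (S → ℝ), (G.toEnd w).IsLightlikeEigendirection G.form p →
      p ∈ G.limitRoots ∧
      ∀ (y : S → ℝ) (hy : y ≠ 0), y ∉ (G.toEnd w).unimodularSubspace →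
        G.IsLimitDirectionThrough (fun k => w ^ k) (Projectivization.mk ℝ y hy) p :=
  mainTheorem6_general G (.of_isLorentzian hG) w hw
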